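/- Let $\mathbf{k}$ be a commutative ring and let $a, b \in \mathbf{k}$. Let $\mathcal{F}$ be the free $\mathbf{k}$-algebra with generators $x_1, x_2, x_3, \ldots$; it has a basis consisting of the words $x_\gamma := x_{\gamma_1} x_{\gamma_2} \cdots x_{\gamma_\ell}$, where $\gamma = (\gamma_1, \ldots, \gamma_\ell)$ ranges over all compositions (finite lists of positive integers), and we write $\ell(\gamma) = \ell$ and $|\gamma| = \gamma_1 + \cdots + \gamma_\ell$. For each positive integer $n$, let $\zeta_n : \mathcal{F} \to \mathcal{F}$ be the $\mathbf{k}$-linear map with $\zeta_n(1) = 0$ and $\zeta_n(x_i w) = x_{i+n} w$ for each $i \geq 1$ and each word $w$. The *stufufuffle product* $\# : \mathcal{F} \times \mathcal{F} \to \mathcal{F}$ is the $\mathbf{k}$-bilinear map defined recursively by $1 \# w = w \# 1 = w$ for each word $w$, and $$(x_i u) \# (x_j v) = x_i \bigl(u \# (x_j v)\bigr) + x_j \bigl((x_i u) \# v\bigr) + a\, x_{i+j} (u \# v) + b\, \zeta_{i+j}(u \# v)$$ for all $i, j \geq 1$ and all words $u, v$. Let $\operatorname{QSym}$ be the $\mathbf{k}$-algebra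 of quasisymmetric functions over $\mathbf{k}$ (inside the power series ring in countably many commuting variables), and let $M_\beta$ denote its monomial quasisymmetric functions. For a composition $\alpha$ let $D(\alpha) = \{\alpha_1 + \cdots + \alpha_i \mid 1 \leq i \leq \ell(\alpha) - 1\}$. For $q \in \mathbf{k}$ define the enriched $q$-monomial function $$\eta_\alpha^{(q)} = \sum_{\substack{\beta \text{ composition},\ |\beta| = |\alpha|,\\ D(\beta) \subseteq D(\alpha)}} (q+1)^{\ell(\beta)} M_\beta \in \operatorname{QSym}.$$ For $q, u \in \mathbf{k}$ let $\operatorname{eta}_{q,u} : \mathcal{F} \to \operatorname{QSym}$ be the $\mathbf{k}$-linear map that sends $x_\alpha$ to $u^{\ell(\alpha)} \eta_\alpha^{(q)}$ for each composition $\alpha$. **Theorem.** 1. The bilinear map $\#$ is commutative and associative, and $1 \in \mathcal{F}$ is a neutral element for it. Thus the $\mathbf{k}$-module $\mathcal{F}$, equipped with $\#$ as multiplication, is a commutative $\mathbf{k}$-algebra with unity $1$. 2. Let $q, u \in \mathbf{k}$ be such that $a = (q-1)u$ and $b = -qu^2$. Then $\operatorname{eta}_{q,u}(g \# h) = \operatorname{eta}_{q,u}(g)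 \cdot \operatorname{eta}_{q,u}(h)$ for all $g, h \in \mathcal{F}$, and $\operatorname{eta}_{q,u}$ is a $\mathbf{k}$-algebra homomorphism from $(\mathcal{F}, \#)$ to $\operatorname{QSym}$. -/

import Mathlib

noncomputable section

namespace Stufufuffle

/-! ## Quasisymmetric functions

The variables `x₁, x₂, x₃, …` of the power series ring are indexed by `ℕ+`; a monomial is a finitely
supported exponent function `ℕ+ →₀ ℕ`. -/

/-- The monomial `x_{i₁}^{c₁} x_{i₂}^{c₂} ⋯ x_{i_ℓ}^{c_ℓ}`, as an exponent function. -/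
def monomialAt {l : ℕ} (i : Fin l → ℕ+) (c : Fin l → ℕ) : ℕ+ →₀ ℕ :=
  ∑ t, Finsupp.single (i t) (c t)

/-- Two monomials are pack-equivalent if they can be written as
`x_{i₁}^{a₁} ⋯ x_{i_ℓ}^{a_ℓ}` and `x_{j₁}^{a₁} ⋯ x_{j_ℓ}^{a_ℓ}` with positive exponents `a` and
strictly increasing tuples `i` and `j`. -/
def PackEquiv (m n : ℕ+ →₀ ℕ) : Prop :=
  ∃ (l : ℕ) (a : Fin l → ℕ+) (i j : Fin l → ℕ+), StrictMono i ∧ StrictMono j ∧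
    m = monomialAt i (fun t => (a t : ℕ)) ∧ n = monomialAt j (fun t => (a t : ℕ))

variable {k : Type*} [CommRing k]

/-- Pack-equivalent monomials have equal coefficients. -/
def IsQuasisymmetric (f : MvPowerSeries ℕ+ k) : Prop :=
  ∀ m n : ℕ+ →₀ ℕ, PackEquiv m n → MvPowerSeries.coeff m f = MvPowerSeries.coeff n f

/-- Some `d` bounds the degrees of all monomials with nonzero coefficient. -/
def IsBoundedDegree (f : MvPowerSeries ℕ+ k) : Prop :=
  ∃ d : ℕ, ∀ m : ℕ+ →₀ ℕ, d < m.degree → MvPowerSeries.coeff m f = 0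

theorem monomialAt_eq_mapDomain {l : ℕ} (i : Fin l → ℕ+) (c : Fin l →₀ ℕ) :
    monomialAt i c = c.mapDomain i := by
  rw [monomialAt, Finsupp.mapDomain, Finsupp.sum_fintype _ _ (by simp)]

theorem degree_monomialAt {l : ℕ} (i : Fin l → ℕ+) (c : Fin l → ℕ) :
    (monomialAt i c).degree = ∑ t, c t := by
  simp [monomialAt, Finsupp.degree_single]

theorem PackEquiv.symm {m n : ℕ+ →₀ ℕ} (h : PackEquiv m n) : PackEquiv n m := by
  obtain ⟨l, a, i, j, hi, hj, hm, hn⟩ := h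
  exact ⟨l, a, j, i, hj, hi, hn, hm⟩

theorem PackEquiv.degree_eq {m n : ℕ+ →₀ ℕ} (h : PackEquiv m n) : m.degree = n.degree := by
  obtain ⟨l, a, i, j, hi, hj, rfl, rfl⟩ := h
  simp [degree_monomialAt]

/-- The list of nonzero exponents of a monomial, in increasing order of the variables. -/
def pack (m : ℕ+ →₀ ℕ) : List ℕ := (m.support.sort (· ≤ ·)).map m

theorem pack_monomialAt {l : ℕ} (a : Fin l → ℕ+) (i : Fin l → ℕ+) (hi : StrictMono i) :
    pack (monomialAt i (fun t => (a t : ℕ))) = List.ofFn (fun t => (a t : ℕ)) := by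
  have hval : ∀ t, monomialAt i (fun t => (a t : ℕ)) (i t) = a t := by
    intro t
    simp [monomialAt, Finsupp.finsetSum_apply, Finsupp.single_apply, hi.injective.eq_iff]
  have hsupp : (monomialAt i (fun t => (a t : ℕ))).support = (List.ofFn i).toFinset := by
    ext x
    simp only [Finsupp.mem_support_iff, List.mem_toFinset, List.mem_ofFn]
    constructor
    · intro hx
      by_contra hne
      apply hx
      simp only [monomialAt, Finsupp.finsetSum_apply]
      refine Finset.sum_eq_zero fun t _ => ?_
      rw [Finsupp.single_apply, if_neg]
      exact fun h => hne ⟨t, h⟩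
    · rintro ⟨t, rfl⟩
      rw [hval]
      exact (a t).ne_zero
  have hsort : (List.ofFn i).toFinset.sort (· ≤ ·) = List.ofFn i := by
    rw [List.toFinset_sort _ (List.nodup_ofFn.2 hi.injective)]
    exact (List.sortedLT_ofFn_iff.2 hi).sortedLE.pairwise
  rw [pack, hsupp, hsort, List.map_ofFn]
  congr 1
  funext t
  exact hval t

theorem PackEquiv.trans {m n p : ℕ+ →₀ ℕ} (h : PackEquiv m n) (h' : PackEquiv n p) :
    PackEquiv m p := by
  obtain ⟨l, a, i, j, hi, hj, rfl, rfl⟩ := h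
  obtain ⟨l', a', i', j', hi', hj', hn, rfl⟩ := h'
  have hp := congrArg pack hn
  rw [pack_monomialAt a j hj, pack_monomialAt a' i' hi'] at hp
  obtain rfl : l = l' := by simpa using congrArg List.length hp
  have ha : a = a' := by
    funext t
    exact PNat.coe_injective (congrFun (List.ofFn_injective hp) t)
  subst ha
  exact ⟨l, a, i, j', hi, hj', rfl, rfl⟩

theorem packEquiv_monomialAt {l : ℕ} (c : Fin l → ℕ) (i j : Fin l → ℕ+) (hi : StrictMono i)
    (hj : StrictMono j) : PackEquiv (monomialAt i c) (monomialAt j c) := by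
  set s : Finset (Fin l) := Finset.univ.filter (fun t => c t ≠ 0) with hs
  set e := s.orderEmbOfFin rfl with he
  have hpos : ∀ r, 0 < c (e r) := fun r =>
    Nat.pos_of_ne_zero (Finset.mem_filter.1 (s.orderEmbOfFin_mem rfl r)).2
  have key : ∀ i : Fin l → ℕ+, monomialAt i c = monomialAt (fun r => i (e r)) (fun r => c (e r)) := by
    intro i
    have h1 : monomialAt i c = ∑ t ∈ s, Finsupp.single (i t) (c t) := by
      rw [monomialAt]
      symm
      refine Finset.sum_subset (Finset.subset_univ _) fun t _ ht => ?_
      have : c t = 0 := by simpa [hs] using ht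
      simp [this]
    have h2 := Finset.sum_map Finset.univ e.toEmbedding (fun t => Finsupp.single (i t) (c t))
    rw [he, Finset.map_orderEmbOfFin_univ s rfl, ← he] at h2
    rw [h1, h2]
    rfl
  refine ⟨s.card, fun r => (c (e r)).toPNat (hpos r), fun r => i (e r), fun r => j (e r),
    hi.comp e.strictMono, hj.comp e.strictMono, ?_, ?_⟩
  · exact key i
  · exact key j

theorem coeff_mul_monomialAt {l : ℕ} (c : Fin l →₀ ℕ) (i : Fin l → ℕ+) (hi : StrictMono i)
    (f g : MvPowerSeries ℕ+ k) :
    MvPowerSeries.coeff (monomialAt i c) (f * g) =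
      ∑ p ∈ Finset.HasAntidiagonal.antidiagonal c, MvPowerSeries.coeff (monomialAt i p.1) f *
        MvPowerSeries.coeff (monomialAt i p.2) g := by
  classical
  rw [MvPowerSeries.coeff_mul]
  symm
  refine Finset.sum_nbij (fun p => (monomialAt i p.1, monomialAt i p.2)) ?_ ?_ ?_ ?_
  · intro p hp
    rw [Finset.HasAntidiagonal.mem_antidiagonal] at hp ⊢
    simp only [monomialAt_eq_mapDomain]
    rw [← Finsupp.mapDomain_add, hp]
  · rintro ⟨p, q⟩ _ ⟨p', q'⟩ _ h
    simp only [Prod.mk.injEq, monomialAt_eq_mapDomain] at h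
    exact Prod.ext (Finsupp.mapDomain_injective hi.injective h.1)
      (Finsupp.mapDomain_injective hi.injective h.2)
  · rintro ⟨p, q⟩ h
    rw [Finset.mem_coe, Finset.HasAntidiagonal.mem_antidiagonal, monomialAt_eq_mapDomain] at h
    dsimp only at h
    have hr : ∀ x ∉ Set.range i, p x = 0 ∧ q x = 0 := by
      intro x hx
      have h0 := DFunLike.congr_fun h x
      rw [Finsupp.mapDomain_of_notMem_range _ _ hx, Finsupp.add_apply] at h0
      omega
    have hp : (p.comapDomain i hi.injective.injOn).mapDomain i = p :=
      Finsupp.mapDomain_comapDomain i hi.injective p fun x hx => by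
        by_contra hne
        exact (Finsupp.mem_support_iff.1 hx) (hr x hne).1
    have hq : (q.comapDomain i hi.injective.injOn).mapDomain i = q :=
      Finsupp.mapDomain_comapDomain i hi.injective q fun x hx => by
        by_contra hne
        exact (Finsupp.mem_support_iff.1 hx) (hr x hne).2
    refine ⟨(p.comapDomain i hi.injective.injOn, q.comapDomain i hi.injective.injOn), ?_, ?_⟩
    · rw [Finset.mem_coe, Finset.HasAntidiagonal.mem_antidiagonal]
      apply Finsupp.mapDomain_injective hi.injective
      rw [Finsupp.mapDomain_add, hp, hq, h]
    · simp only [monomialAt_eq_mapDomain, hp, hq]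
  · intro p _
    rfl

theorem IsQuasisymmetric.mul {f g : MvPowerSeries ℕ+ k} (hf : IsQuasisymmetric f)
    (hg : IsQuasisymmetric g) : IsQuasisymmetric (f * g) := by
  rintro _ _ ⟨l, a, i, j, hi, hj, rfl, rfl⟩
  have h := fun (i : Fin l → ℕ+) (hi : StrictMono i) =>
    coeff_mul_monomialAt (Finsupp.equivFunOnFinite.symm fun t => (a t : ℕ)) i hi f g
  rw [Finsupp.coe_equivFunOnFinite_symm] at h
  rw [h i hi, h j hj]
  refine Finset.sum_congr rfl fun p _ => ?_
  rw [hf _ _ (packEquiv_monomialAt p.1 i j hi hj), hg _ _ (packEquiv_monomialAt p.2 i j hi hj)]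

theorem IsBoundedDegree.mul {f g : MvPowerSeries ℕ+ k} (hf : IsBoundedDegree f)
    (hg : IsBoundedDegree g) : IsBoundedDegree (f * g) := by
  classical
  obtain ⟨d, hd⟩ := hf
  obtain ⟨e, he⟩ := hg
  refine ⟨d + e, fun m hm => ?_⟩
  rw [MvPowerSeries.coeff_mul]
  refine Finset.sum_eq_zero fun p hp => ?_
  rw [Finset.HasAntidiagonal.mem_antidiagonal] at hp
  have hdeg : p.1.degree + p.2.degree = m.degree := by rw [← hp, map_add]
  rcases lt_or_ge d p.1.degree with h | h
  · rw [hd _ h, zero_mul]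
  · rw [he _ (by omega), mul_zero]

variable (k) in
/-- The `k`-algebra `QSym` of quasisymmetric functions: the power series in `x₁, x₂, x₃, …` over `k`
that are quasisymmetric and of bounded degree. -/
def QSym : Subalgebra k (MvPowerSeries ℕ+ k) where
  carrier := {f | IsQuasisymmetric f ∧ IsBoundedDegree f}
  mul_mem' hf hg := ⟨hf.1.mul hg.1, hf.2.mul hg.2⟩
  add_mem' := by
    rintro f g ⟨hf, d, hd⟩ ⟨hg, e, he⟩
    refine ⟨fun m n h => ?_, max d e, fun m hm => ?_⟩
    · rw [map_add, map_add, hf m n h, hg m n h]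
    · rw [map_add, hd m (lt_of_le_of_lt (le_max_left _ _) hm),
        he m (lt_of_le_of_lt (le_max_right _ _) hm), add_zero]
  algebraMap_mem' c := by
    classical
    refine ⟨fun m n h => ?_, 0, fun m hm => ?_⟩
    · have hmn : m = 0 ↔ n = 0 := by
        rw [← Finsupp.degree_eq_zero_iff, ← Finsupp.degree_eq_zero_iff, h.degree_eq]
      simp only [MvPowerSeries.algebraMap_apply, Algebra.algebraMap_self, RingHom.id_apply,
        MvPowerSeries.coeff_C, hmn]
    · have hm0 : m ≠ 0 := by
        rintro rfl
        simp at hm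
      simp [MvPowerSeries.algebraMap_apply, MvPowerSeries.coeff_C, hm0]

/-! ## Compositions

A composition is a finite list of positive integers, i.e. an element of `List ℕ+`; its length is
`List.length`. -/

/-- The size `α₁ + α₂ + ⋯ + α_ℓ`. -/
def size (α : List ℕ+) : ℕ := (α.map (fun i : ℕ+ => (i : ℕ))).sum

/-- The set `D(α) = {α₁ + α₂ + ⋯ + αᵢ ∣ 1 ≤ i ≤ ℓ - 1}`. -/
def partialSums (α : List ℕ+) : Finset ℕ :=
  (Finset.Ico 1 α.length).image (fun i => size (α.take i))

/-- The finite set of all compositions of `n`, transported from Mathlib's `Composition n`. -/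
def compositionsOf (n : ℕ) : Finset (List ℕ+) :=
  (Finset.univ : Finset (Composition n)).image
    (fun c => List.ofFn (fun t => (c.blocksFun t).toPNat (c.one_le_blocksFun t)))

theorem mem_compositionsOf {n : ℕ} {α : List ℕ+} : α ∈ compositionsOf n ↔ size α = n := by
  simp only [compositionsOf, Finset.mem_image, Finset.mem_univ, true_and]
  constructor
  · rintro ⟨c, rfl⟩
    rw [size, List.map_ofFn, List.sum_ofFn]
    exact c.sum_blocksFun
  · rintro rfl
    refine ⟨⟨α.map (fun i : ℕ+ => (i : ℕ)), ?_, rfl⟩, ?_⟩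
    · intro i hi
      obtain ⟨j, _, rfl⟩ := List.mem_map.1 hi
      exact j.pos
    · apply List.ext_get
      · simp [Composition.length]
      · intro t h1 h2
        simp [Composition.blocksFun]
        rfl

/-- The monomial `x₁^{α₁} x₂^{α₂} ⋯ x_ℓ^{α_ℓ}`. -/
def leadingMonomial (α : List ℕ+) : ℕ+ →₀ ℕ :=
  monomialAt (fun t : Fin α.length => t.val.succPNat) (fun t => ((α.get t : ℕ+) : ℕ))

variable (k) in
open Classical in
/-- The monomial quasisymmetric function
`M_α = ∑_{i₁ < ⋯ < i_ℓ} x_{i₁}^{α₁} ⋯ x_{i_ℓ}^{α_ℓ}`: the sum of all monomials that are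
pack-equivalent to `x₁^{α₁} ⋯ x_ℓ^{α_ℓ}`. -/
def monomialSeries (α : List ℕ+) : MvPowerSeries ℕ+ k :=
  fun m => if PackEquiv m (leadingMonomial α) then 1 else 0

theorem coeff_monomialSeries (α : List ℕ+) (m : ℕ+ →₀ ℕ) [Decidable (PackEquiv m (leadingMonomial α))] :
    MvPowerSeries.coeff m (monomialSeries k α) =
      if PackEquiv m (leadingMonomial α) then 1 else 0 := by
  rw [MvPowerSeries.coeff_apply, monomialSeries]
  congr

theorem monomialSeries_mem (α : List ℕ+) : monomialSeries k α ∈ QSym k := by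
  classical
  refine ⟨fun m n h => ?_, size α, fun m hm => ?_⟩
  · rw [coeff_monomialSeries, coeff_monomialSeries]
    congr 1
    exact propext ⟨fun h' => h.symm.trans h', fun h' => h.trans h'⟩
  · rw [coeff_monomialSeries, if_neg]
    intro h
    have h1 := h.degree_eq
    rw [leadingMonomial, degree_monomialAt] at h1
    have h2 : size α = ∑ t : Fin α.length, ((α.get t : ℕ+) : ℕ) := by
      rw [← List.sum_ofFn, size]
      congr 1
      conv_lhs => rw [← List.ofFn_get α, List.map_ofFn]
      rfl
    omega

variable (k) in
/-- `M_α` as an element of `QSym`. -/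
def M (α : List ℕ+) : QSym k := ⟨monomialSeries k α, monomialSeries_mem α⟩

/-- The enriched `q`-monomial function
`η_α^{(q)} = ∑_{β ∈ Comp_{|α|}, D(β) ⊆ D(α)} (q + 1)^{ℓ(β)} M_β`. -/
def enriched (q : k) (α : List ℕ+) : QSym k :=
  ∑ β ∈ (compositionsOf (size α)).filter (fun β => partialSums β ⊆ partialSums α),
    (q + 1) ^ β.length • M k β

/-! ## The free algebra and the stufufuffle product -/

variable (k) in
/-- The free `k`-algebra on the letters `x₁, x₂, x₃, …`. -/
abbrev F : Type _ := FreeAlgebra k ℕ+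

variable (k) in
/-- The letter `x_i`. -/
def letter (i : ℕ+) : F k := FreeAlgebra.ι k i

variable (k) in
/-- The word `x_γ = x_{γ₁} x_{γ₂} ⋯ x_{γ_ℓ}` (the product in the free algebra). -/
def word (γ : List ℕ+) : F k := (γ.map (letter k)).prod

variable (k) in
/-- The basis of the free algebra consisting of all words, indexed by compositions. -/
def wordBasis : Module.Basis (List ℕ+) k (F k) :=
  (FreeAlgebra.basisFreeMonoid k ℕ+).reindex FreeMonoid.toList

theorem wordBasis_apply (γ : List ℕ+) : wordBasis k γ = word k γ := by
  have h : ∀ γ : FreeMonoid ℕ+, FreeAlgebra.basisFreeMonoid k ℕ+ γ =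
      FreeMonoid.lift (FreeAlgebra.ι k) γ := by
    intro γ
    simp [FreeAlgebra.basisFreeMonoid, FreeAlgebra.equivMonoidAlgebraFreeMonoid]
  rw [wordBasis, Module.Basis.reindex_apply, h, FreeMonoid.lift_apply]
  rfl

/-- The value of `ζ_n` on a word: `ζ_n(1) = 0` and `ζ_n(x_i w) = x_{i+n} w`. -/
def zetaWord (n : ℕ+) : List ℕ+ → F k
  | [] => 0
  | i :: w => letter k (i + n) * word k w

/-- The `k`-linear operator `ζ_n`, for positive `n`. -/
def zeta (n : ℕ+) : F k →ₗ[k] F k := (wordBasis k).constr k (zetaWord n)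

/-- The stufufuffle product of two words. -/
def stufWord (a b : k) : List ℕ+ → List ℕ+ → F k
  | [], w => word k w
  | i :: u, [] => word k (i :: u)
  | i :: u, j :: v =>
      letter k i * stufWord a b u (j :: v) + letter k j * stufWord a b (i :: u) v
        + a • (letter k (i + j) * stufWord a b u v) + b • zeta (i + j) (stufWord a b u v)
termination_by u v => u.length + v.length

/-- The stufufuffle product `#` with parameters `a` and `b`, as a `k`-bilinear map. -/
def stuf (a b : k) : F k →ₗ[k] F k →ₗ[k] F k :=
  (wordBasis k).constr k (fun u => (wordBasis k).constr k (fun v => stufWord a b u v))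

/-- The `k`-linear map `F → QSym` that sends `x_α` to `u^{ℓ(α)} η_α^{(q)}`. -/
def eta (q u : k) : F k →ₗ[k] QSym k :=
  (wordBasis k).constr k (fun α => u ^ α.length • enriched q α)

/-! The defining properties of `ζ_n`, `#` and `eta`. -/

theorem zeta_one (n : ℕ+) : zeta n (1 : F k) = 0 := by
  have h : (1 : F k) = wordBasis k [] := by rw [wordBasis_apply]; simp [word]
  rw [h, zeta, Module.Basis.constr_basis, zetaWord]

theorem zeta_cons (n i : ℕ+) (w : List ℕ+) :
    zeta n (letter k i * word k w) = letter k (i + n) * word k w := by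
  have h : letter k i * word k w = wordBasis k (i :: w) := by rw [wordBasis_apply]; simp [word]
  rw [h, zeta, Module.Basis.constr_basis, zetaWord]

theorem stuf_word_word (a b : k) (u v : List ℕ+) :
    stuf a b (word k u) (word k v) = stufWord a b u v := by
  rw [← wordBasis_apply, ← wordBasis_apply, stuf, Module.Basis.constr_basis,
    Module.Basis.constr_basis]

theorem stuf_one_word (a b : k) (w : List ℕ+) : stuf a b 1 (word k w) = word k w := by
  have h := stuf_word_word a b [] w
  rwa [stufWord, show word k [] = 1 by simp [word]] at h

theorem stuf_word_one (a b : k) (w : List ℕ+) : stuf a b (word k w) 1 = word k w := by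
  have h := stuf_word_word a b w []
  rw [show word k [] = 1 by simp [word]] at h
  rw [h]
  cases w <;> rw [stufWord]

theorem stuf_cons_cons (a b : k) (i j : ℕ+) (u v : List ℕ+) :
    stuf a b (letter k i * word k u) (letter k j * word k v) =
      letter k i * stuf a b (word k u) (letter k j * word k v)
      + letter k j * stuf a b (letter k i * word k u) (word k v)
      + a • (letter k (i + j) * stuf a b (word k u) (word k v))
      + b • zeta (i + j) (stuf a b (word k u) (word k v)) := by
  have h : ∀ (i : ℕ+) (w : List ℕ+), letter k i * word k w = word k (i :: w) := by
    intro i w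
    simp [word]
  simp only [h, stuf_word_word]
  rw [stufWord]

theorem eta_word (q u : k) (α : List ℕ+) :
    eta q u (word k α) = u ^ α.length • enriched q α := by
  rw [← wordBasis_apply, eta, Module.Basis.constr_basis]

variable (k) in
/-- A copy of the set `F` that carries no algebraic structure of its own. -/
def Carrier : Type _ := F k

/-- The identification of `F` with its structureless copy. -/
def toCarrier : F k ≃ Carrier k := Equiv.refl _

end Stufufuffle

end

/-!
Commutativity of `#` is an induction on the total length of two words. For associativity the point is
how `ζ_n` commutes with `#` (`zeta_stuf_letter_mul`). With it, the recursion for a product of three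
words (`stuf_stuf_letter_mul`) is symmetric in the three factors up to associativity for shorter
words, so that `(f # g) # h = (h # g) # f` by induction, and commutativity turns this into
associativity.

For the multiplicativity of `eta`, write `H` and `H'` for the map `eta` followed by restriction to the
variables `y, y₂, …, y_m` and `y₂, …, y_m`, respectively. Sorting the monomials of `η_α` by whether `y`
absorbs the first letter gives
`H (x_i v) = H' (x_i v) + u y^i (H v + q H' v)`,
which is used as the definition of `H` (`evalWord`). It implies
`H (ζ_n p) = H' (ζ_n p) + y^n (H p - H' p)`,
and with these two formulas the recursion of `#` yields `H (g # h) = H g * H h` by induction on the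
number of variables and on the lengths of the words (`eval_stuf`); the relations `a = (q - 1) u` and
`b = -q u²` are exactly what makes the terms at `y^(i+j)` agree.

The coefficient of a monomial in `η_α` is `(q + 1)^ℓ` if its list of `ℓ` nonzero exponents arises from
`α` by adding up consecutive entries, and zero otherwise (`coeff_enriched`, `coarsens_iff`). The
coefficients of `H` are the same, up to the factor `u ^ ℓ(α)` (`coeff_evalWord`). Since a coefficient
of a product at `m` involves only the finitely many variables of `m`, this suffices to deduce that
`eta` is multiplicative.
-/

noncomputable section

namespace Stufufuffle

variable {k : Type*} [CommRing k]

/-! ### The product on the free algebra -/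

theorem word_nil : word k [] = 1 := by simp [word]

theorem word_cons (i : ℕ+) (w : List ℕ+) : word k (i :: w) = letter k i * word k w := by
  simp [word]

theorem word_induction {P : F k → Prop} (hword : ∀ w, P (word k w))
    (hadd : ∀ g h, P g → P h → P (g + h)) (hsmul : ∀ (c : k) (g), P g → P (c • g)) (g : F k) :
    P g := by
  refine Submodule.span_induction (p := fun g _ => P g) ?_ ?_ (fun g h _ _ => hadd g h)
    (fun c g _ => hsmul c g) ((wordBasis k).mem_span g)
  · rintro _ ⟨w, rfl⟩
    rw [wordBasis_apply]
    exact hword w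
  · simpa using hsmul 0 _ (hword [])

theorem zeta_letter_mul (n i : ℕ+) (p : F k) :
    zeta n (letter k i * p) = letter k (i + n) * p := by
  induction p using word_induction with
  | hword w => exact zeta_cons n i w
  | hadd p p' hp hp' => rw [mul_add, map_add, hp, hp', mul_add]
  | hsmul c p hp => rw [mul_smul_comm, map_smul, hp, mul_smul_comm]

theorem zeta_zeta (m n : ℕ+) (p : F k) : zeta m (zeta n p) = zeta (n + m) p := by
  induction p using word_induction with
  | hword w =>
    cases w with
    | nil => simp [word_nil, zeta_one]
    | cons i w => simp only [word_cons, zeta_letter_mul, add_assoc]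
  | hadd p p' hp hp' => simp only [map_add, hp, hp']
  | hsmul c p hp => simp only [map_smul, hp]

theorem one_stuf (a b : k) (g : F k) : stuf a b 1 g = g := by
  induction g using word_induction with
  | hword w => exact stuf_one_word a b w
  | hadd p p' hp hp' => rw [map_add, hp, hp']
  | hsmul c p hp => rw [map_smul, hp]

theorem stuf_one (a b : k) (g : F k) : stuf a b g 1 = g := by
  induction g using word_induction with
  | hword w => exact stuf_word_one a b w
  | hadd p p' hp hp' => rw [map_add, LinearMap.add_apply, hp, hp']
  | hsmul c p hp => rw [map_smul, LinearMap.smul_apply, hp]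

/-- The defining recursion of `#`, extended bilinearly from words to all elements. -/
theorem stuf_letter_mul_letter_mul (a b : k) (i j : ℕ+) (p r : F k) :
    stuf a b (letter k i * p) (letter k j * r) =
      letter k i * stuf a b p (letter k j * r) + letter k j * stuf a b (letter k i * p) r
        + a • (letter k (i + j) * stuf a b p r) + b • zeta (i + j) (stuf a b p r) := by
  induction p using word_induction with
  | hword u =>
    induction r using word_induction with
    | hword v => exact stuf_cons_cons a b i j u v
    | hadd p p' hp hp' => simp only [map_add, mul_add, hp, hp']; module
    | hsmul c p hp => simp only [map_smul, mul_smul_comm, hp]; module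
  | hadd p p' hp hp' => simp only [map_add, mul_add, LinearMap.add_apply, hp, hp']; module
  | hsmul c p hp => simp only [map_smul, mul_smul_comm, LinearMap.smul_apply, hp]; module

theorem stuf_comm (a b : k) (g h : F k) : stuf a b g h = stuf a b h g := by
  have key : ∀ (n : ℕ) (u v : List ℕ+), u.length + v.length ≤ n →
      stuf a b (word k u) (word k v) = stuf a b (word k v) (word k u) := by
    intro n
    induction n with
    | zero =>
      intro u v h
      obtain rfl : u = [] := List.length_eq_zero_iff.1 (by omega)
      obtain rfl : v = [] := List.length_eq_zero_iff.1 (by omega)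
      rfl
    | succ n ih =>
      intro u v h
      rcases u with _ | ⟨i, u⟩
      · rw [word_nil, one_stuf, stuf_one]
      rcases v with _ | ⟨j, v⟩
      · rw [word_nil, one_stuf, stuf_one]
      simp only [List.length_cons] at h
      have h1 := ih u (j :: v) (by simp only [List.length_cons]; omega)
      have h2 := ih (i :: u) v (by simp only [List.length_cons]; omega)
      have h3 := ih u v (by omega)
      simp only [word_cons] at h1 h2 ⊢
      rw [stuf_letter_mul_letter_mul, stuf_letter_mul_letter_mul, h1, h2, h3, add_comm j i,
        add_comm (letter k i * _)]
  induction g using word_induction with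
  | hword u =>
    induction h using word_induction with
    | hword v => exact key _ u v le_rfl
    | hadd p p' hp hp' => rw [map_add, map_add, LinearMap.add_apply, hp, hp']
    | hsmul c p hp => rw [map_smul, map_smul, LinearMap.smul_apply, hp]
  | hadd p p' hp hp' => rw [map_add, map_add, LinearMap.add_apply, hp, hp']
  | hsmul c p hp => rw [map_smul, map_smul, LinearMap.smul_apply, hp]

/-- How `ζ_n` commutes with `#`. It holds for every `p`: on words with a first letter it is the
recursion of `#` read for the shifted letter, and for `p = 1` both sides vanish. -/
theorem zeta_stuf_letter_mul (a b : k) (n j : ℕ+) (p r : F k) :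
    stuf a b (zeta n p) (letter k j * r) =
      zeta n (stuf a b p (letter k j * r)) - letter k (j + n) * stuf a b p r
        + letter k j * stuf a b (zeta n p) r := by
  induction p using word_induction with
  | hword w =>
    cases w with
    | nil => simp [word_nil, zeta_one, one_stuf, zeta_letter_mul]
    | cons i w =>
      simp only [word_cons, zeta_letter_mul, stuf_letter_mul_letter_mul, map_add, map_smul,
        zeta_zeta, add_right_comm i n j]
      module
  | hadd p p' hp hp' => simp only [map_add, mul_add, LinearMap.add_apply, hp, hp']; module
  | hsmul c p hp => simp only [map_smul, mul_smul_comm, LinearMap.smul_apply, hp]; module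

/-- The recursion for a product of three factors. Up to commutativity and associativity for shorter
factors, its right-hand side is symmetric in the three factors, which is the reason for the
associativity of `#`. -/
theorem stuf_stuf_letter_mul (a b : k) (i j l : ℕ+) (p r s : F k) :
    stuf a b (stuf a b (letter k i * p) (letter k j * r)) (letter k l * s) =
      letter k i * stuf a b (stuf a b p (letter k j * r)) (letter k l * s)
      + letter k j * stuf a b (stuf a b (letter k i * p) r) (letter k l * s)
      + letter k l * stuf a b (stuf a b (letter k i * p) (letter k j * r)) s
      + a • (letter k (i + j) * stuf a b (stuf a b p r) (letter k l * s)
        + letter k (i + l) * stuf a b (stuf a b p (letter k j * r)) s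
        + letter k (j + l) * stuf a b (stuf a b (letter k i * p) r) s)
      + b • (zeta (i + j) (stuf a b (stuf a b p r) (letter k l * s))
        + zeta (i + l) (stuf a b (stuf a b p (letter k j * r)) s)
        + zeta (j + l) (stuf a b (stuf a b (letter k i * p) r) s))
      + (a ^ 2 - b) • (letter k (i + j + l) * stuf a b (stuf a b p r) s)
      + (a * b) • zeta (i + j + l) (stuf a b (stuf a b p r) s) := by
  rw [stuf_letter_mul_letter_mul a b i j p r]
  simp only [map_add, map_smul, LinearMap.add_apply, LinearMap.smul_apply, mul_add, mul_smul_comm,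
    zeta_stuf_letter_mul, stuf_letter_mul_letter_mul a b _ l, add_comm l (i + j)]
  module

theorem stuf_assoc (a b : k) (f g h : F k) :
    stuf a b (stuf a b f g) h = stuf a b f (stuf a b g h) := by
  -- Exchanging the outer factors is what the symmetry of the three-factor recursion gives.
  have key : ∀ (n : ℕ) (u v w : List ℕ+), u.length + v.length + w.length ≤ n →
      stuf a b (stuf a b (word k u) (word k v)) (word k w) =
        stuf a b (stuf a b (word k w) (word k v)) (word k u) := by
    intro n
    induction n with
    | zero =>
      intro u v w h
      obtain rfl : u = [] := List.length_eq_zero_iff.1 (by omega)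
      obtain rfl : w = [] := List.length_eq_zero_iff.1 (by omega)
      rfl
    | succ n ih =>
      intro u v w h
      rcases u with _ | ⟨i, u⟩
      · rw [word_nil, one_stuf, stuf_one, stuf_comm]
      rcases v with _ | ⟨j, v⟩
      · rw [word_nil, stuf_one, stuf_one, stuf_comm]
      rcases w with _ | ⟨l, w⟩
      · rw [word_nil, one_stuf, stuf_one, stuf_comm]
      simp only [List.length_cons] at h
      have h1 := ih u (j :: v) (l :: w) (by simp only [List.length_cons]; omega)
      have h2 := ih (i :: u) v (l :: w) (by simp only [List.length_cons]; omega)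
      have h3 := ih (i :: u) (j :: v) w (by simp only [List.length_cons]; omega)
      have h4 := ih u v (l :: w) (by simp only [List.length_cons]; omega)
      have h5 := ih u (j :: v) w (by simp only [List.length_cons]; omega)
      have h6 := ih (i :: u) v w (by simp only [List.length_cons]; omega)
      have h7 := ih u v w (by omega)
      simp only [word_cons] at h1 h2 h3 h4 h5 h6 h7 ⊢
      rw [stuf_stuf_letter_mul, stuf_stuf_letter_mul, h1, h2, h3, h4, h5, h6, h7, add_comm l i,
        add_comm l j, add_comm j i, show j + l + i = i + j + l by ring]
      module
  have hassoc : ∀ u v w : List ℕ+, stuf a b (stuf a b (word k u) (word k v)) (word k w) =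
      stuf a b (word k u) (stuf a b (word k v) (word k w)) := by
    intro u v w
    rw [key _ u v w le_rfl, stuf_comm a b _ (word k u), stuf_comm a b (word k w)]
  induction f using word_induction with
  | hword u =>
    induction g using word_induction with
    | hword v =>
      induction h using word_induction with
      | hword w => exact hassoc u v w
      | hadd p p' hp hp' => simp only [map_add, hp, hp']
      | hsmul c p hp => simp only [map_smul, hp]
    | hadd p p' hp hp' => simp only [map_add, LinearMap.add_apply, hp, hp']
    | hsmul c p hp => simp only [map_smul, LinearMap.smul_apply, hp]
  | hadd p p' hp hp' => simp only [map_add, LinearMap.add_apply, hp, hp']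
  | hsmul c p hp => simp only [map_smul, LinearMap.smul_apply, hp]

/-! ### Multiplicativity in finitely many variables -/

section Eval

variable {R : Type*} [CommRing R] [Algebra k R]

/-- The value of `u ^ ℓ(α) • η_α^{(q)}` at the finite sequence of variables `y₁, …, y_m`, defined by
splitting off the first variable and the first letter. -/
def evalWord (q u : k) : List R → List ℕ+ → R
  | _, [] => 1
  | [], _ :: _ => 0
  | y :: L, i :: v =>
    evalWord q u L (i :: v) + u • (y ^ (i : ℕ) * (evalWord q u (y :: L) v + q • evalWord q u L v))
termination_by L w => L.length + w.length

/-- The linear extension of `evalWord` to the free algebra. -/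
def eval (q u : k) (L : List R) : F k →ₗ[k] R := (wordBasis k).constr k (evalWord q u L)

theorem eval_word (q u : k) (L : List R) (w : List ℕ+) :
    eval q u L (word k w) = evalWord q u L w := by
  rw [← wordBasis_apply, eval, Module.Basis.constr_basis]

theorem eval_one (q u : k) (L : List R) : eval q u L 1 = 1 := by
  rw [← word_nil, eval_word, evalWord]

theorem eval_nil_letter_mul (q u : k) (i : ℕ+) (p : F k) :
    eval q u ([] : List R) (letter k i * p) = 0 := by
  induction p using word_induction with
  | hword w => rw [← word_cons, eval_word, evalWord]
  | hadd p p' hp hp' => rw [mul_add, map_add, hp, hp', add_zero]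
  | hsmul c p hp => rw [mul_smul_comm, map_smul, hp, smul_zero]

theorem eval_nil_zeta (q u : k) (n : ℕ+) (p : F k) : eval q u ([] : List R) (zeta n p) = 0 := by
  induction p using word_induction with
  | hword w =>
    cases w with
    | nil => rw [word_nil, zeta_one, map_zero]
    | cons i w => rw [word_cons, zeta_letter_mul, eval_nil_letter_mul]
  | hadd p p' hp hp' => rw [map_add, map_add, hp, hp', add_zero]
  | hsmul c p hp => rw [map_smul, map_smul, hp, smul_zero]

theorem eval_cons_letter_mul (q u : k) (y : R) (L : List R) (i : ℕ+) (p : F k) :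
    eval q u (y :: L) (letter k i * p) = eval q u L (letter k i * p)
      + u • (y ^ (i : ℕ) * (eval q u (y :: L) p + q • eval q u L p)) := by
  induction p using word_induction with
  | hword w => rw [← word_cons, eval_word, eval_word, eval_word, eval_word, evalWord]
  | hadd p p' hp hp' =>
    simp only [mul_add, map_add, hp, hp', smul_add]
    abel
  | hsmul c p hp =>
    simp only [mul_smul_comm, map_smul, hp, smul_add, mul_add, smul_comm c]

/-- For `p = x_i v` this compares the recursions of `eval` at `x_{i+n} v` and at `x_i v`; for `p = 1`
both sides vanish. -/
theorem eval_cons_zeta (q u : k) (y : R) (L : List R) (n : ℕ+) (p : F k) :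
    eval q u (y :: L) (zeta n p) = eval q u L (zeta n p)
      + y ^ (n : ℕ) * (eval q u (y :: L) p - eval q u L p) := by
  induction p using word_induction with
  | hword w =>
    cases w with
    | nil => simp [word_nil, zeta_one, eval_one]
    | cons i w =>
      rw [word_cons, zeta_letter_mul, eval_cons_letter_mul, eval_cons_letter_mul, PNat.add_coe,
        pow_add, add_sub_cancel_left, mul_smul_comm, mul_comm (y ^ (i : ℕ)), mul_assoc]
  | hadd p p' hp hp' =>
    simp only [map_add, hp, hp']
    ring
  | hsmul c p hp =>
    simp only [map_smul, hp, smul_add, ← smul_sub, mul_smul_comm]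

/-- The induction is on the number of variables and on the lengths of the two words; the step is an
identity of polynomials, which uses the relations between `a`, `b`, `q` and `u`. -/
theorem eval_stuf {a b q u : k} (ha : a = (q - 1) * u) (hb : b = -q * u ^ 2) (L : List R)
    (g h : F k) : eval q u L (stuf a b g h) = eval q u L g * eval q u L h := by
  induction L generalizing g h with
  | nil =>
    induction g using word_induction with
    | hword s =>
      induction h using word_induction with
      | hword t =>
        rcases s with _ | ⟨i, s⟩
        · rw [word_nil, one_stuf, eval_one, one_mul]
        rcases t with _ | ⟨j, t⟩
        · rw [word_nil, stuf_one, eval_one, mul_one]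
        simp [word_cons, stuf_letter_mul_letter_mul, eval_nil_letter_mul, eval_nil_zeta]
      | hadd p p' hp hp' => simp only [map_add, hp, hp', mul_add]
      | hsmul c p hp => simp only [map_smul, hp, mul_smul_comm]
    | hadd p p' hp hp' => simp only [map_add, LinearMap.add_apply, hp, hp', add_mul]
    | hsmul c p hp => simp only [map_smul, LinearMap.smul_apply, hp, smul_mul_assoc]
  | cons y L ihL =>
    have key : ∀ (n : ℕ) (s t : List ℕ+), s.length + t.length ≤ n →
        eval q u (y :: L) (stuf a b (word k s) (word k t)) =
          eval q u (y :: L) (word k s) * eval q u (y :: L) (word k t) := by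
      intro n
      induction n with
      | zero =>
        intro s t h
        obtain rfl : s = [] := List.length_eq_zero_iff.1 (by omega)
        rw [word_nil, one_stuf, eval_one, one_mul]
      | succ n ih =>
        intro s t h
        rcases s with _ | ⟨i, s⟩
        · rw [word_nil, one_stuf, eval_one, one_mul]
        rcases t with _ | ⟨j, t⟩
        · rw [word_nil, stuf_one, eval_one, mul_one]
        simp only [List.length_cons] at h
        have h1 := ih s (j :: t) (by simp only [List.length_cons]; omega)
        have h2 := ih (i :: s) t (by simp only [List.length_cons]; omega)
        have h3 := ih s t (by omega)
        have h0 := ihL (word k (i :: s)) (word k (j :: t))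
        simp only [word_cons] at h0 h1 h2 ⊢
        rw [stuf_letter_mul_letter_mul] at h0 ⊢
        simp only [map_add, map_smul, eval_cons_letter_mul, eval_cons_zeta, h1, h2, h3, ihL,
          PNat.add_coe, pow_add] at h0 ⊢
        simp only [Algebra.smul_def, ha, hb, map_mul, map_sub, map_neg, map_pow, map_one] at h0 ⊢
        linear_combination h0
    induction g using word_induction with
    | hword s =>
      induction h using word_induction with
      | hword t => exact key _ s t le_rfl
      | hadd p p' hp hp' => simp only [map_add, hp, hp', mul_add]
      | hsmul c p hp => simp only [map_smul, hp, mul_smul_comm]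
    | hadd p p' hp hp' => simp only [map_add, LinearMap.add_apply, hp, hp', add_mul]
    | hsmul c p hp => simp only [map_smul, LinearMap.smul_apply, hp, smul_mul_assoc]

end Eval

/-! ### Coarsenings of compositions -/

/-- `Coarsens β α` says that the list `β` arises from the composition `α` by adding up consecutive
entries. The recursion removes the first entry of `α`, which either is the first entry of `β` or is
its first summand. -/
def Coarsens : List ℕ → List ℕ+ → Prop
  | [], [] => True
  | [], _ :: _ => False
  | _ :: _, [] => False
  | b :: β, i :: α => (b = i ∧ Coarsens β α) ∨ ((i : ℕ) < b ∧ Coarsens ((b - i) :: β) α)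

theorem coarsens_nil_right {β : List ℕ} : Coarsens β [] ↔ β = [] := by
  cases β <;> simp [Coarsens]

theorem size_nil : size [] = 0 := rfl

theorem size_cons (i : ℕ+) (α : List ℕ+) : size (i :: α) = i + size α := by simp [size]

theorem size_append (α β : List ℕ+) : size (α ++ β) = size α + size β := by simp [size]

theorem size_eq_zero {α : List ℕ+} : size α = 0 ↔ α = [] := by
  cases α with
  | nil => simp [size_nil]
  | cons i α =>
    have := i.pos
    simp only [size_cons, reduceCtorEq, iff_false]
    omega

theorem mem_partialSums {α : List ℕ+} {x : ℕ} :
    x ∈ partialSums α ↔ (∃ t, size (α.take t) = x) ∧ x ≠ 0 ∧ x ≠ size α := by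
  simp only [partialSums, Finset.mem_image, Finset.mem_Ico]
  constructor
  · rintro ⟨t, ⟨h1, h2⟩, rfl⟩
    refine ⟨⟨t, rfl⟩, ?_, fun h => ?_⟩
    · rw [Ne, size_eq_zero, List.take_eq_nil_iff]
      rintro (h | h)
      · omega
      · simp [h] at h2
    · conv_rhs at h => rw [← List.take_append_drop t α, size_append]
      have h3 : size (α.drop t) = 0 := by omega
      rw [size_eq_zero, List.drop_eq_nil_iff] at h3
      omega
  · rintro ⟨⟨t, rfl⟩, h1, h2⟩
    refine ⟨t, ⟨?_, ?_⟩, rfl⟩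
    · by_contra h
      obtain rfl : t = 0 := by omega
      exact h1 (by simp [size_nil])
    · by_contra h
      exact h2 (by rw [List.take_of_length_le (by omega)])

/-- For compositions of the same size, `D(β) ⊆ D(α)` may be tested on all initial sums, the empty
and the full one included. -/
theorem partialSums_subset_iff {α β : List ℕ+} (h : size β = size α) :
    partialSums β ⊆ partialSums α ↔ ∀ s, ∃ t, size (α.take t) = size (β.take s) := by
  constructor
  · intro hsub s
    by_cases h0 : size (β.take s) = 0
    · exact ⟨0, by simp [h0, size_nil]⟩
    by_cases h1 : size (β.take s) = size β
    · exact ⟨α.length, by rw [List.take_length, h1, h]⟩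
    exact (mem_partialSums.1 (hsub (mem_partialSums.2 ⟨⟨s, rfl⟩, h0, h1⟩))).1
  · intro hs x hx
    obtain ⟨⟨s, rfl⟩, h0, h1⟩ := mem_partialSums.1 hx
    exact mem_partialSums.2 ⟨hs s, h0, h ▸ h1⟩

theorem forall_take_cons {P : ℕ → Prop} (i : ℕ+) (α : List ℕ+) :
    (∀ s, P (size ((i :: α).take s))) ↔ P 0 ∧ ∀ s, P (i + size (α.take s)) := by
  constructor
  · exact fun h => ⟨by simpa [size_nil] using h 0, fun s => by simpa [size_cons] using h (s + 1)⟩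
  · rintro ⟨h0, h⟩ (_ | s)
    · simpa [size_nil] using h0
    · simpa [size_cons] using h s

theorem exists_take_cons (i : ℕ+) (α : List ℕ+) (x : ℕ) :
    (∃ t, size ((i :: α).take t) = x) ↔ x = 0 ∨ ∃ t, i + size (α.take t) = x := by
  constructor
  · rintro ⟨_ | t, rfl⟩
    · simp [size_nil]
    · exact Or.inr ⟨t, by simp [size_cons]⟩
  · rintro (rfl | ⟨t, rfl⟩)
    · exact ⟨0, by simp [size_nil]⟩
    · exact ⟨t + 1, by simp [size_cons]⟩

theorem coarsens_iff_take (α β : List ℕ+) :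
    Coarsens (β.map (fun i : ℕ+ => (i : ℕ))) α ↔
      size β = size α ∧ ∀ s, ∃ t, size (α.take t) = size (β.take s) := by
  induction α generalizing β with
  | nil =>
    rw [coarsens_nil_right, List.map_eq_nil_iff, size_nil, size_eq_zero]
    refine ⟨?_, fun h => h.1⟩
    rintro rfl
    simp [size_nil]
  | cons i α ih =>
    rcases β with _ | ⟨b, β⟩
    · have := i.pos
      simp only [List.map_nil, Coarsens, size_nil, size_cons, false_iff, not_and]
      omega
    have hzero : ∃ t, size (α.take t) = 0 := ⟨0, by simp [size_nil]⟩
    have hi := i.pos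
    have hb := b.pos
    rw [List.map_cons, Coarsens, forall_take_cons (P := fun x => ∃ t, size ((i :: α).take t) = x)]
    simp only [exists_take_cons, true_or, true_and, size_cons]
    constructor
    · rintro (⟨h, hc⟩ | ⟨h, hc⟩)
      · obtain ⟨h1, h2⟩ := (ih β).1 hc
        refine ⟨by omega, fun s => Or.inr ?_⟩
        obtain ⟨t, ht⟩ := h2 s
        exact ⟨t, by omega⟩
      · have hbi : ((b - i : ℕ+) : ℕ) = b - i := by
          rw [PNat.sub_coe, if_pos (PNat.coe_lt_coe _ _ |>.1 h)]
        have hc' := (ih ((b - i) :: β)).1 (by rwa [List.map_cons, hbi])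
        rw [forall_take_cons (P := fun x => ∃ t, size (α.take t) = x), size_cons, hbi] at hc'
        obtain ⟨h1, -, h2⟩ := hc'
        refine ⟨by omega, fun s => Or.inr ?_⟩
        obtain ⟨t, ht⟩ := h2 s
        exact ⟨t, by omega⟩
    · rintro ⟨h1, h2⟩
      have h2' : ∀ s, ∃ t, i + size (α.take t) = b + size (β.take s) := fun s =>
        (h2 s).resolve_left (by omega)
      obtain ⟨t0, ht0⟩ := h2' 0
      rw [List.take_zero, size_nil] at ht0
      by_cases h : (b : ℕ) = i
      · refine Or.inl ⟨h, (ih β).2 ⟨by omega, fun s => ?_⟩⟩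
        obtain ⟨t, ht⟩ := h2' s
        exact ⟨t, by omega⟩
      · have hlt : (i : ℕ) < b := by omega
        have hbi : ((b - i : ℕ+) : ℕ) = b - i := by
          rw [PNat.sub_coe, if_pos (PNat.coe_lt_coe _ _ |>.1 hlt)]
        refine Or.inr ⟨hlt, ?_⟩
        rw [← hbi, ← List.map_cons (f := fun i : ℕ+ => (i : ℕ)), ih,
          forall_take_cons (P := fun x => ∃ t, size (α.take t) = x), size_cons, hbi]
        refine ⟨by omega, hzero, fun s => ?_⟩
        obtain ⟨t, ht⟩ := h2' s
        exact ⟨t, by omega⟩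

theorem coarsens_iff (α β : List ℕ+) :
    Coarsens (β.map (fun i : ℕ+ => (i : ℕ))) α ↔
      size β = size α ∧ partialSums β ⊆ partialSums α := by
  rw [coarsens_iff_take]
  exact and_congr_right fun h => (partialSums_subset_iff h).symm

/-! ### Coefficients -/

theorem pack_eq_filter {m : ℕ+ →₀ ℕ} {l : List ℕ+} (hl : l.Pairwise (· < ·))
    (hm : ∀ x, m x ≠ 0 → x ∈ l) : pack m = (l.map m).filter (· ≠ 0) := by
  have h : m.support.sort (· ≤ ·) = l.filter (fun x => m x ≠ 0) := by
    have hs := hl.filter (fun x => m x ≠ 0)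
    have he : (l.filter (fun x => m x ≠ 0)).toFinset = m.support := by
      ext x
      simpa using hm x
    rw [← he, List.toFinset_sort _ (hs.imp ne_of_lt)]
    exact hs.imp le_of_lt
  rw [pack, h, List.filter_map]
  rfl

theorem pack_leadingMonomial (β : List ℕ+) :
    pack (leadingMonomial β) = β.map (fun i : ℕ+ => (i : ℕ)) := by
  have hmono : StrictMono (fun t : Fin β.length => t.val.succPNat) := fun s t h =>
    Nat.succPNat_strictMono h
  have h := pack_monomialAt β.get _ hmono
  rw [leadingMonomial, h]
  conv_rhs => rw [← List.ofFn_get β, List.map_ofFn]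
  rfl

theorem PackEquiv.pack_eq {m n : ℕ+ →₀ ℕ} (h : PackEquiv m n) : pack m = pack n := by
  obtain ⟨l, a, i, j, hi, hj, rfl, rfl⟩ := h
  rw [pack_monomialAt a i hi, pack_monomialAt a j hj]

theorem exists_packEquiv_leadingMonomial (m : ℕ+ →₀ ℕ) :
    ∃ β : List ℕ+, PackEquiv m (leadingMonomial β) := by
  set e := m.support.orderEmbOfFin rfl with he
  have hpos : ∀ t, 0 < m (e t) := fun t =>
    Nat.pos_of_ne_zero (Finsupp.mem_support_iff.1 (m.support.orderEmbOfFin_mem rfl t))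
  have hm : m = monomialAt e (fun t => m (e t)) := by
    have h := Finset.sum_map Finset.univ e.toEmbedding (fun x => Finsupp.single x (m x))
    rw [he, Finset.map_orderEmbOfFin_univ m.support rfl, ← he] at h
    rw [monomialAt]
    exact (Finsupp.sum_single m).symm.trans h
  set a : Fin m.support.card → ℕ+ := fun t => (m (e t)).toPNat (hpos t) with ha
  refine ⟨List.ofFn a, _, a, e, fun t => t.val.succPNat, e.strictMono, fun s t h =>
    Nat.succPNat_strictMono h, hm, ?_⟩
  rw [leadingMonomial, monomialAt, monomialAt]
  refine Fintype.sum_equiv (finCongr List.length_ofFn) _ _ fun t => ?_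
  simp
  rfl

theorem packEquiv_leadingMonomial_iff {m : ℕ+ →₀ ℕ} {β : List ℕ+} :
    PackEquiv m (leadingMonomial β) ↔ pack m = β.map (fun i : ℕ+ => (i : ℕ)) := by
  constructor
  · intro h
    rw [h.pack_eq, pack_leadingMonomial]
  · intro h
    obtain ⟨γ, hγ⟩ := exists_packEquiv_leadingMonomial m
    rw [hγ.pack_eq, pack_leadingMonomial] at h
    rwa [← List.map_injective_iff.2 PNat.coe_injective h]

open Classical in
/-- At most one `M_β` contributes to the coefficient at `m`, namely the one with `β = pack m`. -/
theorem coeff_enriched (q : k) (α : List ℕ+) (m : ℕ+ →₀ ℕ) :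
    MvPowerSeries.coeff m (enriched q α : MvPowerSeries ℕ+ k) =
      if Coarsens (pack m) α then (q + 1) ^ (pack m).length else 0 := by
  obtain ⟨γ, hγ⟩ := exists_packEquiv_leadingMonomial m
  have hp := packEquiv_leadingMonomial_iff.1 hγ
  have hiff : ∀ β, PackEquiv m (leadingMonomial β) ↔ γ = β := fun β => by
    rw [packEquiv_leadingMonomial_iff, hp]
    exact (List.map_injective_iff.2 PNat.coe_injective).eq_iff
  rw [enriched, AddSubmonoidClass.coe_finsetSum, map_sum]
  simp only [Subalgebra.coe_smul, M, map_smul, coeff_monomialSeries, hiff, smul_eq_mul, mul_ite,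
    mul_one, mul_zero, Finset.sum_ite_eq, Finset.mem_filter, mem_compositionsOf]
  rw [hp, List.length_map]
  exact if_congr (coarsens_iff α γ).symm rfl rfl

theorem coeff_X_pow_mul (m : ℕ+ →₀ ℕ) (x : ℕ+) (n : ℕ) (f : MvPowerSeries ℕ+ k) :
    MvPowerSeries.coeff m (MvPowerSeries.X x ^ n * f) =
      if n ≤ m x then MvPowerSeries.coeff (m - Finsupp.single x n) f else 0 := by
  classical
  rw [MvPowerSeries.X_pow_eq, MvPowerSeries.coeff_monomial_mul, one_mul]
  simp only [Finsupp.single_le_iff]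

theorem coeff_evalWord_eq_zero (q u : k) {l : List ℕ+} {m : ℕ+ →₀ ℕ} {x : ℕ+} (hx : x ∉ l)
    (hm : m x ≠ 0) (w : List ℕ+) :
    MvPowerSeries.coeff m (evalWord q u (l.map (MvPowerSeries.X (R := k))) w) = 0 := by
  classical
  have hone : ∀ m : ℕ+ →₀ ℕ, m x ≠ 0 → MvPowerSeries.coeff m (1 : MvPowerSeries ℕ+ k) = 0 := by
    intro m hm
    rw [MvPowerSeries.coeff_one, if_neg]
    rintro rfl
    exact hm rfl
  induction l generalizing m w with
  | nil =>
    cases w with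
    | nil => rw [evalWord, hone m hm]
    | cons i w => rw [List.map_nil, evalWord, map_zero]
  | cons y l ihl =>
    simp only [List.mem_cons, not_or] at hx
    induction w generalizing m with
    | nil => rw [evalWord, hone m hm]
    | cons i w ihw =>
      rw [List.map_cons, evalWord, map_add, ihl hx.2 hm, map_smul, coeff_X_pow_mul]
      have hm' : (m - Finsupp.single y (i : ℕ)) x ≠ 0 := by
        rwa [Finsupp.tsub_apply, Finsupp.single_eq_of_ne hx.1, tsub_zero]
      rw [List.map_cons] at ihw
      rw [map_add, map_smul, ihw hm', ihl hx.2 hm']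
      simp

open Classical in
/-- The list of nonzero exponents along `l` decides the coefficient. In the recursion of `evalWord` at
the first variable `y` and the first letter `i`, the exponent of `y` is `0`, less than `i`, equal to `i`
or greater than `i`; these cases match the recursion of `Coarsens`. -/
theorem coeff_evalWord (q u : k) {l : List ℕ+} (hl : l.Nodup) {m : ℕ+ →₀ ℕ}
    (hm : ∀ x, m x ≠ 0 → x ∈ l) (w : List ℕ+) :
    MvPowerSeries.coeff m (evalWord q u (l.map (MvPowerSeries.X (R := k))) w) =
      if Coarsens ((l.map m).filter (· ≠ 0)) w then
        u ^ w.length * (q + 1) ^ ((l.map m).filter (· ≠ 0)).length else 0 := by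
  have hone : ∀ (l : List ℕ+) (m : ℕ+ →₀ ℕ), (∀ x, m x ≠ 0 → x ∈ l) →
      MvPowerSeries.coeff m (1 : MvPowerSeries ℕ+ k) =
        if Coarsens ((l.map m).filter (· ≠ 0)) [] then
          u ^ ([] : List ℕ+).length * (q + 1) ^ ((l.map m).filter (· ≠ 0)).length else 0 := by
    intro l m hm
    rw [MvPowerSeries.coeff_one]
    have h : m = 0 ↔ (l.map m).filter (· ≠ 0) = [] := by
      rw [List.filter_eq_nil_iff]
      simp only [List.mem_map, forall_exists_index, and_imp, forall_apply_eq_imp_iff₂,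
        decide_eq_true_eq, not_not]
      constructor
      · rintro rfl x _
        rfl
      · intro h
        ext x
        by_contra hx
        exact hx (h x (hm x hx))
    rw [coarsens_nil_right, ← h]
    split_ifs with h0
    · rw [h.1 h0]
      simp
    · rfl
  induction l generalizing m w with
  | nil =>
    cases w with
    | nil => rw [evalWord]; exact hone _ m hm
    | cons i w => simp [evalWord, Coarsens]
  | cons y l ihl =>
    obtain ⟨hy, hl⟩ := List.nodup_cons.1 hl
    induction w generalizing m with
    | nil => rw [evalWord]; exact hone _ m hm
    | cons i w ihw =>
      have hi := i.pos
      rw [List.map_cons, evalWord, map_add, map_smul, coeff_X_pow_mul, map_add, map_smul,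
        List.map_cons]
      have hmem : ∀ m' : ℕ+ →₀ ℕ, (∀ x, m' x ≠ 0 → x ∈ y :: l) → m' y = 0 →
          ∀ x, m' x ≠ 0 → x ∈ l := by
        intro m' hm' h0 x hx
        rcases List.mem_cons.1 (hm' x hx) with rfl | h
        · exact absurd h0 hx
        · exact h
      by_cases h0 : m y = 0
      · rw [if_neg (by omega), smul_zero, add_zero, ihl hl (hmem m hm h0), h0,
          List.filter_cons_of_neg (by simp)]
      rw [coeff_evalWord_eq_zero q u hy h0, zero_add, List.filter_cons_of_pos (by simpa using h0)]
      by_cases hle : (i : ℕ) ≤ m y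
      swap
      · rw [if_neg hle, smul_zero, if_neg]
        rintro (h | h) <;> omega
      rw [if_pos hle]
      set m' := m - Finsupp.single y (i : ℕ) with hm'
      have hmy : m' y = m y - i := by rw [hm', Finsupp.tsub_apply, Finsupp.single_eq_same]
      have hml : l.map m' = l.map m := by
        refine List.map_congr_left fun x hx => ?_
        rw [hm', Finsupp.tsub_apply, Finsupp.single_eq_of_ne (by rintro rfl; exact hy hx), tsub_zero]
      have hsub : ∀ x, m' x ≠ 0 → x ∈ y :: l := by
        intro x hx
        refine hm x fun h => hx ?_
        rw [hm', Finsupp.tsub_apply, h, zero_tsub]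
      have h1 := ihw hsub
      rw [List.map_cons, List.map_cons, hml, hmy] at h1
      rw [h1, List.length_cons]
      by_cases heq : m y = i
      -- The first letter is all of the exponent of `y`; this is where the factor `q + 1` arises.
      · have h2 := ihl hl (hmem m' hsub (by omega)) w
        rw [hml] at h2
        rw [h2, List.filter_cons_of_neg (by simp [heq])]
        have hc : ∀ β, Coarsens (m y :: β) (i :: w) ↔ Coarsens β w := fun β => by
          simp [Coarsens, heq]
        rw [hc]
        split_ifs
        · simp only [smul_eq_mul, List.length_cons]
          ring
        · simp
      · rw [coeff_evalWord_eq_zero q u hy (by omega),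
          List.filter_cons_of_pos (by simp only [ne_eq, decide_eq_true_eq]; omega)]
        have hc : ∀ β, Coarsens (m y :: β) (i :: w) ↔ Coarsens ((m y - i) :: β) w := fun β => by
          have hlt : (i : ℕ) < m y := by omega
          simp [Coarsens, heq, hlt]
        rw [hc]
        split_ifs
        · simp only [smul_eq_mul, List.length_cons]
          ring
        · simp

/-! ### The map to quasisymmetric functions -/

/-- The coefficients of `eta g` at monomials in finitely many variables can be computed after
evaluation at these variables. -/
theorem coeff_eta (q u : k) {l : List ℕ+} (hl : l.Pairwise (· < ·)) {m : ℕ+ →₀ ℕ}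
    (hm : ∀ x, m x ≠ 0 → x ∈ l) (g : F k) :
    MvPowerSeries.coeff m (eta q u g : MvPowerSeries ℕ+ k) =
      MvPowerSeries.coeff m (eval q u (l.map (MvPowerSeries.X (R := k))) g) := by
  induction g using word_induction with
  | hword w =>
    rw [eta_word, eval_word, coeff_evalWord q u (hl.imp ne_of_lt) hm, Subalgebra.coe_smul, map_smul,
      coeff_enriched, pack_eq_filter hl hm, smul_eq_mul, mul_ite, mul_zero]
  | hadd p p' hp hp' => simp only [map_add, Subalgebra.coe_add, hp, hp']
  | hsmul c p hp => simp only [map_smul, Subalgebra.coe_smul, hp]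

theorem eta_stuf {a b q u : k} (ha : a = (q - 1) * u) (hb : b = -q * u ^ 2) (g h : F k) :
    eta q u (stuf a b g h) = eta q u g * eta q u h := by
  classical
  refine Subtype.ext (MvPowerSeries.ext fun m => ?_)
  have hl : (m.support.sort (· ≤ ·)).Pairwise (· < ·) := (Finset.sortedLT_sort _).pairwise
  have hm : ∀ x, m x ≠ 0 → x ∈ m.support.sort (· ≤ ·) := fun x hx => by simpa using hx
  rw [coeff_eta q u hl hm, eval_stuf ha hb, Subalgebra.coe_mul, MvPowerSeries.coeff_mul,
    MvPowerSeries.coeff_mul]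
  refine Finset.sum_congr rfl fun p hp => ?_
  rw [Finset.HasAntidiagonal.mem_antidiagonal] at hp
  rw [coeff_eta q u hl, coeff_eta q u hl] <;>
  · intro x hx
    refine hm x ?_
    rw [← hp, Finsupp.add_apply]
    omega

theorem eta_one (q u : k) : eta q u 1 = 1 := by
  classical
  refine Subtype.ext (MvPowerSeries.ext fun m => ?_)
  rw [coeff_eta q u (Finset.sortedLT_sort m.support).pairwise fun x hx => by simpa using hx,
    eval_one, Subalgebra.coe_one]

/-! ### The commutative algebra -/

/-- The free algebra as a commutative ring with multiplication `#`. -/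
@[reducible]
def carrierCommRing (a b : k) : CommRing (Carrier k) :=
  letI : AddCommGroup (Carrier k) := (inferInstance : AddCommGroup (F k))
  { this with
    mul := fun g h => stuf a b g h
    one := (1 : F k)
    mul_assoc := stuf_assoc a b
    mul_comm := stuf_comm a b
    one_mul := one_stuf a b
    mul_one := stuf_one a b
    left_distrib := fun f g h => map_add (stuf a b f) g h
    right_distrib := fun f g h => LinearMap.map_add₂ (stuf a b) f g h
    zero_mul := fun g => LinearMap.map_zero₂ (stuf a b) g
    mul_zero := fun g => map_zero (stuf a b g) }

/-- The `k`-algebra structure on the free algebra with multiplication `#`; the scalar multiplication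
is the one of the free algebra. -/
@[reducible]
def carrierAlgebra (a b : k) : @Algebra k (Carrier k) _ (carrierCommRing a b).toSemiring :=
  letI := carrierCommRing a b
  letI : Module k (Carrier k) := (inferInstance : Module k (F k))
  Algebra.ofModule (fun c g h => LinearMap.map_smul₂ (stuf a b) c g h)
    (fun c g h => map_smul (stuf a b g) c h)

end Stufufuffle

end

open Stufufuffle in
theorem mainTheorem10 {k : Type*} [CommRing k] (a b : k) :
    -- `#` is commutative
    (∀ g h : F k, stuf a b g h = stuf a b h g) ∧
    -- `#` is associative
    (∀ f g h : F k, stuf a b (stuf a b f g) h = stuf a b f (stuf a b g h)) ∧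
    -- `1` is a neutral element for `#`
    (∀ g : F k, stuf a b 1 g = g ∧ stuf a b g 1 = g) ∧
    -- `eta` transports `#` to the product of `QSym`
    (∀ q u : k, a = (q - 1) * u → b = -q * u ^ 2 →
      ∀ g h : F k, eta q u (stuf a b g h) = eta q u g * eta q u h) ∧
    -- the `k`-module `F` with multiplication `#` is a commutative `k`-algebra with unity `1`,
    -- and `eta` is a `k`-algebra homomorphism from it to `QSym`
    (∃ (_ : CommRing (Carrier k)) (_ : Algebra k (Carrier k)),
      (∀ g h : F k, toCarrier (g + h) = toCarrier g + toCarrier h) ∧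
      (∀ (c : k) (g : F k), toCarrier (c • g) = c • toCarrier g) ∧
      (∀ g h : F k, toCarrier (stuf a b g h) = toCarrier g * toCarrier h) ∧
      toCarrier (1 : F k) = 1 ∧
      ∀ q u : k, a = (q - 1) * u → b = -q * u ^ 2 →
        ∃ φ : Carrier k →ₐ[k] QSym k, ∀ g : F k, φ (toCarrier g) = eta q u g) := by
  refine ⟨stuf_comm a b, stuf_assoc a b, fun g => ⟨one_stuf a b g, stuf_one a b g⟩,
    fun q u ha hb => eta_stuf ha hb, ?_⟩
  let _ := carrierCommRing a b
  let _ := carrierAlgebra a b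
  refine ⟨carrierCommRing a b, carrierAlgebra a b, fun _ _ => rfl, fun _ _ => rfl, fun _ _ => rfl,
    rfl, fun q u ha hb => ?_⟩
  let φ : Carrier k →ₗ[k] QSym k :=
    { toFun := fun g => eta q u (toCarrier.symm g)
      map_add' := fun g h => map_add (eta q u) g h
      map_smul' := fun c g => map_smul (eta q u) c g }
  exact ⟨AlgHom.ofLinearMap φ (eta_one q u) (eta_stuf ha hb), fun _ => rfl⟩
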